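/- Let $\{\alpha_{(i,j)}\}_{i,j\ge 0}$ and $\{\beta_{(i,j)}\}_{i,j\ge 0}$ be bounded double-indexed sequences of positive real numbers, and let $\mathbf T\equiv(T_1,T_2)$ be the associated $2$-variable weighted shift, that is, the pair of bounded operators on $\ell^2(\mathbb Z_+^2)$ determined on the canonical orthonormal basis by $$T_1e_{(i,j)}=\alpha_{(i,j)}\,e_{(i+1,j)},\qquad T_2e_{(i,j)}=\beta_{(i,j)}\,e_{(i,j+1)}\qquad(i,j\ge 0).$$ For $j\ge 0$ let the $j$-th horizontal slice $W_{\alpha^{(j)}}:=\mathrm{shift}(\alpha_{(0,j)},\alpha_{(1,j)},\dots)$, and for $i\ge 0$ let the $i$-th vertical slice $W_{\beta^{(i)}}:=\mathrm{shift}(\beta_{(i,0)},\beta_{(i,1)},\dots)$, where $\mathrm{shift}(a_0,a_1,\dots)$ denotes the unilateral weighted shift $e_n\mapsto a_ne_{n+1}$ on $\ell^2(\mathbb Z_+)$. Assume that $\mathbf T$ is subnormal, i.e. there exist a Hilbert space $\mathcal K\supseteq\ell^2(\mathbb Z_+^2)$ and commuting normal operators $N_1,N_2$ on $\mathcal K$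 that leave $\ell^2(\mathbb Z_+^2)$ invariant and satisfy $N_k|_{\ell^2(\mathbb Z_+^2)}=T_k$ $(k=1,2)$. Then $$\|W_{\alpha^{(j)}}\|=\|W_{\alpha^{(1)}}\|\quad\text{for all } j\ge 1,\qquad \|W_{\beta^{(i)}}\|=\|W_{\beta^{(1)}}\|\quad\text{for all } i\ge 1,$$ where $\|\cdot\|$ is the operator norm. -/

import Mathlib

open scoped ENNReal

universe v

noncomputable section

namespace TwoVarShift

/-- The complex Hilbert space `ℓ²(ι)`. -/
abbrev L2 (ι : Type) : Type := lp (fun _ : ι => ℂ) 2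

theorem extend_weighted_hasSum {ι : Type} {σ : ι → ι} (hσ : Function.Injective σ)
    (w : ι → ℝ) (x : ι → ℂ) {a : ℝ} (h : HasSum (fun k => ‖(w k : ℂ) * x k‖ ^ (2 : ℝ)) a) :
    HasSum (fun m => ‖Function.extend σ (fun k => (w k : ℂ) * x k) 0 m‖ ^ (2 : ℝ)) a := by
  refine (hσ.hasSum_iff ?_).1 ?_
  · intro m hm
    have : ¬ ∃ k, σ k = m := hm
    rw [Function.extend_apply' _ _ _ this]
    simp
  · convert h using 2 with k
    simp [hσ.extend_apply]

theorem weighted_le {ι : Type} {w : ι → ℝ} {C : ℝ} (hw : ∀ k, |w k| ≤ C)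
    (x : ι → ℂ) (k : ι) :
    ‖(w k : ℂ) * x k‖ ^ (2 : ℝ) ≤ C ^ (2 : ℝ) * ‖x k‖ ^ (2 : ℝ) := by
  have hC : 0 ≤ C := (abs_nonneg _).trans (hw k)
  rw [← Real.mul_rpow hC (norm_nonneg _)]
  refine Real.rpow_le_rpow (norm_nonneg _) ?_ (by norm_num)
  rw [norm_mul, Complex.norm_real, Real.norm_eq_abs]
  exact mul_le_mul_of_nonneg_right (hw k) (norm_nonneg _)

theorem summable_sq {ι : Type} (x : L2 ι) : Summable fun k => ‖x k‖ ^ (2 : ℝ) := by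
  simpa using (lp.memℓp x).summable (by norm_num)

theorem summable_weighted {ι : Type} {w : ι → ℝ} {C : ℝ} (hw : ∀ k, |w k| ≤ C) (x : L2 ι) :
    Summable fun k => ‖(w k : ℂ) * x k‖ ^ (2 : ℝ) :=
  Summable.of_nonneg_of_le (fun _ => by positivity) (weighted_le hw x)
    ((summable_sq x).mul_left _)

theorem memℓp_extend {ι : Type} {σ : ι → ι} (hσ : Function.Injective σ)
    {w : ι → ℝ} (hw : ∃ C, ∀ k, |w k| ≤ C) (x : L2 ι) :
    Memℓp (Function.extend σ (fun k => (w k : ℂ) * x k) 0) 2 := by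
  obtain ⟨C, hC⟩ := hw
  refine (memℓp_gen_iff (by norm_num)).2 ?_
  simpa using (extend_weighted_hasSum hσ w x (summable_weighted hC x).hasSum).summable

/-- For an injective `σ : ι → ι` and a bounded weight `w`, the bounded operator on `ℓ²(ι)` that
maps the basis vector `e_k` to `w k • e_(σ k)`. In coordinates, `(A x) (σ k) = w k * x k`, and
`(A x) m = 0` when `m` is not in the range of `σ`. -/
def shiftOp {ι : Type} (σ : ι → ι) (hσ : Function.Injective σ) (w : ι → ℝ)
    (hw : ∃ C, ∀ k, |w k| ≤ C) : L2 ι →L[ℂ] L2 ι :=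
  LinearMap.mkContinuousOfExistsBound
    { toFun := fun x =>
        (⟨Function.extend σ (fun k => (w k : ℂ) * x k) 0, memℓp_extend hσ hw x⟩ : L2 ι)
      map_add' := by
        intro x y
        ext m
        change Function.extend σ (fun k => (w k : ℂ) * (x k + y k)) 0 m =
          Function.extend σ (fun k => (w k : ℂ) * x k) 0 m +
            Function.extend σ (fun k => (w k : ℂ) * y k) 0 m
        by_cases hm : ∃ k, σ k = m
        · obtain ⟨k, rfl⟩ := hm
          simp [hσ.extend_apply, mul_add]
        · simp [Function.extend_apply' _ _ _ hm]
      map_smul' := by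
        intro c x
        ext m
        change Function.extend σ (fun k => (w k : ℂ) * (c * x k)) 0 m =
          c * Function.extend σ (fun k => (w k : ℂ) * x k) 0 m
        by_cases hm : ∃ k, σ k = m
        · obtain ⟨k, rfl⟩ := hm
          simp [hσ.extend_apply, mul_left_comm]
        · simp [Function.extend_apply' _ _ _ hm] }
    (by
      obtain ⟨C, hC⟩ := hw
      refine ⟨|C|, fun x => ?_⟩
      have hC' : ∀ k, |w k| ≤ |C| := fun k => (hC k).trans (le_abs_self C)
      refine lp.norm_le_of_tsum_le (by norm_num) (by positivity) ?_
      have h1 := extend_weighted_hasSum hσ w x (summable_weighted hC' x).hasSum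
      have h2 := lp.norm_rpow_eq_tsum (p := 2) (by norm_num) x
      simp only [ENNReal.toReal_ofNat] at h2 ⊢
      rw [Real.mul_rpow (abs_nonneg _) (norm_nonneg _), h2, ← tsum_mul_left]
      refine h1.tsum_eq.le.trans ?_
      exact (summable_weighted hC' x).tsum_le_tsum (weighted_le hC' x)
        ((summable_sq x).mul_left _))

/-- The unilateral weighted shift `shift(a 0, a 1, …)` on `ℓ²(ℤ₊)`: `e_n ↦ a n • e_(n+1)`. -/
def unilateralShift (a : ℕ → ℝ) (ha : ∃ C, ∀ n, |a n| ≤ C) : L2 ℕ →L[ℂ] L2 ℕ :=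
  shiftOp (fun n => n + 1) (add_left_injective 1) a ha

/-- A pair `(T₁, T₂)` of bounded operators on a Hilbert space `H` is (jointly) subnormal if there
are a Hilbert space `K` containing `H` (through a linear isometry `V`) and commuting normal
operators `N₁, N₂` on `K` that leave `H` invariant and restrict to `T₁, T₂` on it. (In particular
`T₁` and `T₂` commute.) -/
def IsSubnormalPair {H : Type} [NormedAddCommGroup H] [InnerProductSpace ℂ H]
    (T₁ T₂ : H →L[ℂ] H) : Prop :=
  ∃ (K : Type v) (_ : NormedAddCommGroup K) (_ : InnerProductSpace ℂ K) (_ : CompleteSpace K)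
    (V : H →ₗᵢ[ℂ] K) (N₁ N₂ : K →L[ℂ] K),
    IsStarNormal N₁ ∧ IsStarNormal N₂ ∧ Commute N₁ N₂ ∧
      (∀ x, N₁ (V x) = V (T₁ x)) ∧ (∀ x, N₂ (V x) = V (T₂ x))

/-- The weights of a `2`-variable weighted shift: two double-indexed bounded sequences of positive
numbers, `α (i, j)` and `β (i, j)` being the weights at `(i, j) ∈ ℤ₊²`. -/
structure Weights where
  α : ℕ × ℕ → ℝ
  β : ℕ × ℕ → ℝ
  α_pos : ∀ k, 0 < α k
  β_pos : ∀ k, 0 < β k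
  α_bdd : ∃ C, ∀ k, |α k| ≤ C
  β_bdd : ∃ C, ∀ k, |β k| ≤ C

namespace Weights

/-- `T₁ e_(i,j) = α_(i,j) e_(i+1,j)` on `ℓ²(ℤ₊²)`. -/
def T₁ (S : Weights) : L2 (ℕ × ℕ) →L[ℂ] L2 (ℕ × ℕ) :=
  shiftOp (fun k => (k.1 + 1, k.2))
    (fun k l h => by simpa [Prod.ext_iff] using h) S.α S.α_bdd

/-- `T₂ e_(i,j) = β_(i,j) e_(i,j+1)` on `ℓ²(ℤ₊²)`. -/
def T₂ (S : Weights) : L2 (ℕ × ℕ) →L[ℂ] L2 (ℕ × ℕ) :=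
  shiftOp (fun k => (k.1, k.2 + 1))
    (fun k l h => by simpa [Prod.ext_iff] using h) S.β S.β_bdd

/-- The `j`-th horizontal slice `W_(α^(j)) = shift(α_(0,j), α_(1,j), …)`. -/
def horizontalSlice (S : Weights) (j : ℕ) : L2 ℕ →L[ℂ] L2 ℕ :=
  unilateralShift (fun n => S.α (n, j)) (S.α_bdd.imp fun _ h n => h (n, j))

/-- The `i`-th vertical slice `W_(β^(i)) = shift(β_(i,0), β_(i,1), …)`. -/
def verticalSlice (S : Weights) (i : ℕ) : L2 ℕ →L[ℂ] L2 ℕ :=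
  unilateralShift (fun n => S.β (i, n)) (S.β_bdd.imp fun _ h n => h (i, n))

end Weights

end TwoVarShift

end

namespace TwoVarShift

theorem shiftOp_apply {ι : Type} {σ : ι → ι} (hσ : Function.Injective σ) (w : ι → ℝ)
    (hw : ∃ C, ∀ k, |w k| ≤ C) (x : L2 ι) :
    ⇑(shiftOp σ hσ w hw x) = Function.extend σ (fun k => (w k : ℂ) * x k) 0 := rfl

theorem shiftOp_single {ι : Type} [DecidableEq ι] {σ : ι → ι} (hσ : Function.Injective σ)
    (w : ι → ℝ) (hw : ∃ C, ∀ k, |w k| ≤ C) (k : ι) :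
    shiftOp σ hσ w hw (lp.single 2 k 1) = (w k : ℂ) • lp.single 2 (σ k) (1 : ℂ) := by
  ext m
  rw [shiftOp_apply, lp.coeFn_smul, Pi.smul_apply]
  by_cases hm : ∃ l, σ l = m
  · obtain ⟨l, rfl⟩ := hm
    rw [hσ.extend_apply]
    by_cases hl : l = k
    · subst hl
      simp
    · simp [Pi.single_eq_of_ne hl, Pi.single_eq_of_ne (hσ.ne hl)]
  · rw [Function.extend_apply' _ _ _ hm]
    have : m ≠ σ k := fun h => hm ⟨k, h.symm⟩
    simp [Pi.single_eq_of_ne this]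

theorem norm_shiftOp_le {ι : Type} {σ : ι → ι} (hσ : Function.Injective σ) (w : ι → ℝ)
    (hw : ∃ C, ∀ k, |w k| ≤ C) {C : ℝ} (hC0 : 0 ≤ C) (hC : ∀ k, |w k| ≤ C) :
    ‖shiftOp σ hσ w hw‖ ≤ C := by
  refine ContinuousLinearMap.opNorm_le_bound _ hC0 fun x => ?_
  refine lp.norm_le_of_tsum_le (by norm_num) (by positivity) ?_
  have h1 := extend_weighted_hasSum hσ w x (summable_weighted hC x).hasSum
  have h2 := lp.norm_rpow_eq_tsum (p := 2) (by norm_num) x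
  simp only [ENNReal.toReal_ofNat] at h2 ⊢
  rw [Real.mul_rpow hC0 (norm_nonneg _), h2, ← tsum_mul_left]
  exact h1.tsum_eq.le.trans ((summable_weighted hC x).tsum_le_tsum (weighted_le hC x)
    ((summable_sq x).mul_left _))

theorem abs_le_norm_shiftOp {ι : Type} {σ : ι → ι} (hσ : Function.Injective σ) (w : ι → ℝ)
    (hw : ∃ C, ∀ k, |w k| ≤ C) (k : ι) : |w k| ≤ ‖shiftOp σ hσ w hw‖ := by
  classical
  have h := (shiftOp σ hσ w hw).le_opNorm (lp.single 2 k 1)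
  rw [shiftOp_single, norm_smul, lp.norm_single (by norm_num), lp.norm_single (by norm_num)] at h
  simpa using h

theorem norm_unilateralShift_le_iff {a : ℕ → ℝ} (ha : ∃ C, ∀ n, |a n| ≤ C) (ha0 : ∀ n, 0 < a n)
    {C : ℝ} (hC : 0 ≤ C) : ‖unilateralShift a ha‖ ≤ C ↔ ∀ n, a n ≤ C :=
  ⟨fun h n => (le_abs_self _).trans ((abs_le_norm_shiftOp _ a ha n).trans h),
    fun h => norm_shiftOp_le _ a ha hC fun n => (abs_of_pos (ha0 n)).le.trans (h n)⟩

theorem norm_apply_sq_le_of_isStarNormal {K : Type*} [NormedAddCommGroup K]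
    [InnerProductSpace ℂ K] [CompleteSpace K] {N : K →L[ℂ] K} (hN : IsStarNormal N) (x : K) :
    ‖N x‖ ^ 2 ≤ ‖x‖ * ‖N (N x)‖ := by
  rw [ContinuousLinearMap.isStarNormal_iff_norm_eq_adjoint.1 hN (N x), mul_comm]
  have h := norm_inner_le_norm (𝕜 := ℂ) (ContinuousLinearMap.adjoint N (N x)) x
  rw [ContinuousLinearMap.adjoint_inner_left, inner_self_eq_norm_sq_to_K] at h
  simpa using h

theorem isStarNormal_pow_mul {A : Type*} [CStarAlgebra A] {a b : A} (ha : IsStarNormal a)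
    (hb : IsStarNormal b) (hab : Commute a b) (m : ℕ) : IsStarNormal (a ^ m * b) := by
  have h1 : Commute (star a) b := IsStarNormal.commute_star_left ha hab
  have h2 : Commute (star b) a := IsStarNormal.commute_star_left hb hab.symm
  refine ⟨?_⟩
  rw [star_mul, star_pow]
  exact ((h2.pow_right m).mul_right hb.star_comm_self).mul_left
    ((ha.star_comm_self.pow_pow m m).mul_right (h1.pow_left m))

/-- The inequality `‖N x‖² ≤ ‖x‖ ‖N² x‖` for the normal operator `N = N₁ ^ m * N₂`, restricted to
the invariant subspace. -/
theorem IsSubnormalPair.norm_pow_mul_sq_le {H : Type} [NormedAddCommGroup H]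
    [InnerProductSpace ℂ H] {A B : H →L[ℂ] H} (h : IsSubnormalPair.{v} A B) (m : ℕ) (x : H) :
    ‖(A ^ m * B) x‖ ^ 2 ≤ ‖x‖ * ‖(A ^ m * B) ((A ^ m * B) x)‖ := by
  obtain ⟨K, _, _, _, V, N₁, N₂, h1, h2, hc, hA, hB⟩ := h
  have hp : ∀ (n : ℕ) (y : H), (N₁ ^ n) (V y) = V ((A ^ n) y) := by
    intro n
    induction n with
    | zero => intro y; rfl
    | succ n ih =>
      intro y
      rw [pow_succ, pow_succ, mul_apply_eq_comp, mul_apply_eq_comp, hA, ih]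
  have hN : ∀ y : H, (N₁ ^ m * N₂) (V y) = V ((A ^ m * B) y) := fun y => by
    rw [mul_apply_eq_comp, mul_apply_eq_comp, hB, hp]
  have := norm_apply_sq_le_of_isStarNormal (isStarNormal_pow_mul h1 h2 hc m) (V x)
  simpa only [hN, V.norm_map] using this

theorem IsSubnormalPair.symm {H : Type} [NormedAddCommGroup H]
    [InnerProductSpace ℂ H] {A B : H →L[ℂ] H} (h : IsSubnormalPair.{v} A B) :
    IsSubnormalPair.{v} B A := by
  obtain ⟨K, i1, i2, i3, V, N₁, N₂, h1, h2, hc, hA, hB⟩ := h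
  exact ⟨K, i1, i2, i3, V, N₂, N₁, h2, h1, hc.symm, hB, hA⟩

theorem IsSubnormalPair.comm_apply {H : Type} [NormedAddCommGroup H]
    [InnerProductSpace ℂ H] {A B : H →L[ℂ] H} (h : IsSubnormalPair.{v} A B) (x : H) :
    A (B x) = B (A x) := by
  obtain ⟨K, _, _, _, V, N₁, N₂, h1, h2, hc, hA, hB⟩ := h
  apply V.injective
  rw [← hA, ← hB, ← hB, ← hA]
  exact DFunLike.congr_fun hc (V x)

theorem IsSubnormalPair.norm_left_sq_le {H : Type} [NormedAddCommGroup H]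
    [InnerProductSpace ℂ H] {A B : H →L[ℂ] H} (h : IsSubnormalPair.{v} A B) (x : H) :
    ‖A x‖ ^ 2 ≤ ‖x‖ * ‖A (A x)‖ := by
  simpa using h.symm.norm_pow_mul_sq_le 0 x

theorem le_of_forall_mul_pow_le {c D r M : ℝ} (hc : 0 < c) (hM : 0 ≤ M)
    (h : ∀ i : ℕ, c * r ^ i ≤ D * M ^ i) : r ≤ M := by
  by_contra! hlt
  rcases hM.eq_or_lt with rfl | hM
  · have := h 1
    simp only [pow_one, mul_zero] at this
    nlinarith
  · obtain ⟨i, hi⟩ := pow_unbounded_of_one_lt (D / c) ((one_lt_div hM).2 hlt)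
    rw [div_pow, div_lt_div_iff₀ hc (by positivity)] at hi
    linarith [h i]

/-- A monotone positive sequence whose partial products satisfy `c * (∏ a) ^ 2 ≤ D * M ^ (2 i)` is
bounded by `M`. -/
theorem le_of_forall_prod_sq_le {a : ℕ → ℝ} (ha : ∀ n, 0 < a n) (hmono : Monotone a)
    {c D M : ℝ} (hc : 0 < c) (hM : 0 ≤ M)
    (h : ∀ i : ℕ, c * (∏ k ∈ Finset.range i, a k) ^ 2 ≤ D * M ^ (2 * i)) (n : ℕ) : a n ≤ M := by
  have hP : 0 < ∏ k ∈ Finset.range n, a k := Finset.prod_pos fun k _ => ha k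
  have key : (a n) ^ 2 ≤ M ^ 2 := by
    refine le_of_forall_mul_pow_le (c := c * (∏ k ∈ Finset.range n, a k) ^ 2)
      (D := D * M ^ (2 * n)) (by positivity) (by positivity) fun i => ?_
    have h1 : a n ^ i ≤ ∏ k ∈ Finset.range i, a (n + k) := by
      calc a n ^ i = ∏ _k ∈ Finset.range i, a n := by simp
        _ ≤ _ := Finset.prod_le_prod (fun _ _ => (ha n).le) fun k _ => hmono (Nat.le_add_right n k)
    have h2 := h (n + i)
    rw [Finset.prod_range_add] at h2
    calc c * (∏ k ∈ Finset.range n, a k) ^ 2 * (a n ^ 2) ^ i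
        = c * ((∏ k ∈ Finset.range n, a k) * a n ^ i) ^ 2 := by ring
      _ ≤ c * ((∏ k ∈ Finset.range n, a k) * ∏ k ∈ Finset.range i, a (n + k)) ^ 2 := by
          have := (ha n).le
          gcongr
      _ ≤ D * M ^ (2 * (n + i)) := h2
      _ = D * M ^ (2 * n) * (M ^ 2) ^ i := by ring
  exact (pow_le_pow_iff_left₀ (ha n).le hM two_ne_zero).1 key

/-- A pair of operators acting as a `2`-variable weighted shift on a lattice of unit vectors. -/
structure IsLatticeShift {H : Type} [NormedAddCommGroup H] [InnerProductSpace ℂ H]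
    (A B : H →L[ℂ] H) (e : ℕ → ℕ → H) (a b : ℕ → ℕ → ℝ) : Prop where
  norm_eq : ∀ i j, ‖e i j‖ = 1
  left : ∀ i j, A (e i j) = (a i j : ℂ) • e (i + 1) j
  right : ∀ i j, B (e i j) = (b i j : ℂ) • e i (j + 1)
  left_pos : ∀ i j, 0 < a i j
  right_pos : ∀ i j, 0 < b i j
  right_bdd : ∃ C, ∀ i j, b i j ≤ C

namespace IsLatticeShift

variable {H : Type} [NormedAddCommGroup H] [InnerProductSpace ℂ H]
  {A B : H →L[ℂ] H} {e : ℕ → ℕ → H} {a b : ℕ → ℕ → ℝ}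

theorem pow_left (hL : IsLatticeShift A B e a b) (m i j : ℕ) :
    (A ^ m) (e i j) = ((∏ k ∈ Finset.range m, a (i + k) j : ℝ) : ℂ) • e (i + m) j := by
  induction m with
  | zero => simp
  | succ m ih =>
    rw [pow_succ', mul_apply_eq_comp, ih, map_smul, hL.left, smul_smul,
      Finset.prod_range_succ]
    push_cast
    rfl

theorem monotone_left (hL : IsLatticeShift A B e a b) (h : IsSubnormalPair.{v} A B) (j : ℕ) :
    Monotone fun i => a i j := by
  refine monotone_nat_of_le_succ fun i => ?_
  have := h.norm_left_sq_le (e i j)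
  simp only [hL.left, map_smul, norm_smul, hL.norm_eq, Complex.norm_real, Real.norm_eq_abs,
    abs_of_pos (hL.left_pos _ _), mul_one, one_mul] at this
  rw [sq] at this
  exact le_of_mul_le_mul_left this (hL.left_pos i j)

theorem commute_weights (hL : IsLatticeShift A B e a b) (h : IsSubnormalPair.{v} A B) (i j : ℕ) :
    a i j * b (i + 1) j = b i j * a i (j + 1) := by
  have := congrArg norm (h.comm_apply (e i j))
  simp only [hL.left, hL.right, map_smul, norm_smul, hL.norm_eq, Complex.norm_real,
    Real.norm_eq_abs, abs_of_pos (hL.left_pos _ _), abs_of_pos (hL.right_pos _ _),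
    mul_one] at this
  exact this.symm

theorem prod_mul_right (hL : IsLatticeShift A B e a b) (h : IsSubnormalPair.{v} A B) (i j : ℕ) :
    (∏ k ∈ Finset.range i, a k j) * b i j = b 0 j * ∏ k ∈ Finset.range i, a k (j + 1) := by
  induction i with
  | zero => simp
  | succ i ih =>
    rw [Finset.prod_range_succ, Finset.prod_range_succ, mul_assoc, hL.commute_weights h,
      ← mul_assoc, ih, mul_assoc]

theorem prod_sq_le (hL : IsLatticeShift A B e a b) (h : IsSubnormalPair.{v} A B) (i j : ℕ) :
    b 0 j * (∏ k ∈ Finset.range i, a k (j + 1)) ^ 2 ≤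
      b 0 (j + 1) * ∏ k ∈ Finset.range (2 * i), a k (j + 2) := by
  have hP : ∀ n l, 0 < ∏ k ∈ Finset.range n, a k l :=
    fun n l => Finset.prod_pos fun k _ => hL.left_pos k l
  have hP' : ∀ n l, 0 < ∏ k ∈ Finset.range n, a (i + k) l :=
    fun n l => Finset.prod_pos fun k _ => hL.left_pos _ l
  have h1 := h.norm_pow_mul_sq_le i (e 0 j)
  simp only [mul_apply_eq_comp, hL.right, hL.pow_left, map_smul, norm_smul, hL.norm_eq,
    Complex.norm_real, Real.norm_eq_abs, abs_of_pos (hL.right_pos _ _), zero_add,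
    abs_of_pos (hP _ _), abs_of_pos (hP' _ _), mul_one, one_mul] at h1
  have h2 := hL.prod_mul_right h i (j + 1)
  rw [two_mul, Finset.prod_range_add]
  refine le_of_mul_le_mul_left ?_ (hL.right_pos 0 j)
  calc b 0 j * (b 0 j * (∏ k ∈ Finset.range i, a k (j + 1)) ^ 2)
      = (b 0 j * ∏ k ∈ Finset.range i, a k (j + 1)) ^ 2 := by ring
    _ ≤ _ := h1
    _ = b 0 j * (((∏ k ∈ Finset.range i, a k (j + 1)) * b i (j + 1)) *
          ∏ k ∈ Finset.range i, a (i + k) (j + 2)) := by ring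
    _ = _ := by rw [h2]; ring

theorem forall_succ_le_iff (hL : IsLatticeShift A B e a b) (h : IsSubnormalPair.{v} A B) (j : ℕ)
    {M : ℝ} (hM : 0 ≤ M) : (∀ i, a i (j + 2) ≤ M) ↔ ∀ i, a i (j + 1) ≤ M := by
  have hle : ∀ {l : ℕ}, (∀ i, a i l ≤ M) → ∀ n, ∏ k ∈ Finset.range n, a k l ≤ M ^ n :=
    fun {l} hl n => (Finset.prod_le_prod (fun k _ => (hL.left_pos k l).le) fun k _ => hl k).trans
      (by simp)
  constructor
  · intro hM'
    refine le_of_forall_prod_sq_le (fun n => hL.left_pos n _) (hL.monotone_left h _)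
      (hL.right_pos 0 j) hM (D := b 0 (j + 1)) fun i => (hL.prod_sq_le h i j).trans ?_
    exact mul_le_mul_of_nonneg_left (hle hM' _) (hL.right_pos _ _).le
  · intro hM'
    obtain ⟨C, hC⟩ := hL.right_bdd
    have hC0 : 0 < C := (hL.right_pos 0 0).trans_le (hC 0 0)
    refine le_of_forall_prod_sq_le (fun n => hL.left_pos n _) (hL.monotone_left h _)
      (c := b 0 (j + 1) ^ 2) (pow_pos (hL.right_pos 0 _) 2) hM (D := C ^ 2) fun i => ?_
    rw [← mul_pow, ← hL.prod_mul_right h, mul_comm 2 i, pow_mul, ← mul_pow, mul_comm C]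
    refine pow_le_pow_left₀ ?_ (mul_le_mul (hle hM' i) (hC _ _) (hL.right_pos _ _).le
      (by positivity)) 2
    exact mul_nonneg (Finset.prod_nonneg fun k _ => (hL.left_pos k _).le) (hL.right_pos _ _).le

theorem norm_unilateralShift_eq (hL : IsLatticeShift A B e a b) (h : IsSubnormalPair.{v} A B)
    (ha : ∀ j, ∃ C, ∀ n, |a n j| ≤ C) {j : ℕ} (hj : 1 ≤ j) :
    ‖unilateralShift (fun n => a n j) (ha j)‖ = ‖unilateralShift (fun n => a n 1) (ha 1)‖ := by
  induction j, hj using Nat.le_induction with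
  | base => rfl
  | succ j hj ih =>
    obtain ⟨j, rfl⟩ := Nat.exists_eq_add_of_le' hj
    rw [← ih]
    have hiff := fun l {M : ℝ} (hM : 0 ≤ M) =>
      norm_unilateralShift_le_iff (ha l) (fun n => hL.left_pos n l) hM
    apply le_antisymm
    · rw [hiff _ (norm_nonneg _), hL.forall_succ_le_iff h _ (norm_nonneg _),
        ← hiff _ (norm_nonneg _)]
    · rw [hiff _ (norm_nonneg _), ← hL.forall_succ_le_iff h _ (norm_nonneg _),
        ← hiff _ (norm_nonneg _)]

end IsLatticeShift

namespace Weights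

theorem isLatticeShift (S : Weights) :
    IsLatticeShift S.T₁ S.T₂ (fun i j => lp.single 2 (i, j) 1) (fun i j => S.α (i, j))
      (fun i j => S.β (i, j)) where
  norm_eq i j := by simp [lp.norm_single]
  left i j := shiftOp_single _ _ _ _
  right i j := shiftOp_single _ _ _ _
  left_pos _ _ := S.α_pos _
  right_pos _ _ := S.β_pos _
  right_bdd := S.β_bdd.imp fun _ h _ _ => (le_abs_self _).trans (h _)

theorem isLatticeShift_swap (S : Weights) :
    IsLatticeShift S.T₂ S.T₁ (fun i j => lp.single 2 (j, i) 1) (fun i j => S.β (j, i))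
      (fun i j => S.α (j, i)) where
  norm_eq i j := by simp [lp.norm_single]
  left i j := shiftOp_single _ _ _ _
  right i j := shiftOp_single _ _ _ _
  left_pos _ _ := S.β_pos _
  right_pos _ _ := S.α_pos _
  right_bdd := S.α_bdd.imp fun _ h _ _ => (le_abs_self _).trans (h _)

end Weights

end TwoVarShift

theorem theorem2p3 (S : TwoVarShift.Weights)
    (hS : TwoVarShift.IsSubnormalPair.{v} S.T₁ S.T₂) :
    (∀ j : ℕ, 1 ≤ j → ‖S.horizontalSlice j‖ = ‖S.horizontalSlice 1‖) ∧
      (∀ i : ℕ, 1 ≤ i → ‖S.verticalSlice i‖ = ‖S.verticalSlice 1‖) :=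
  ⟨fun _ hj => S.isLatticeShift.norm_unilateralShift_eq hS
      (fun j => S.α_bdd.imp fun _ h n => h (n, j)) hj,
    fun _ hi => S.isLatticeShift_swap.norm_unilateralShift_eq hS.symm
      (fun i => S.β_bdd.imp fun _ h n => h (i, n)) hi⟩
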